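/- Let $H_{\mathbb{C}}$ be the complex Heisenberg group, i.e. the Lie group of complex matrices of the form $$\begin{pmatrix}1&u_2&u_3\\0&1&u_1\\0&0&1\end{pmatrix},\qquad u_1,u_2,u_3\in\mathbb{C}.$$ Let $\Lambda\subset\mathbb{C}$ be the lattice generated by $1$ and $\zeta=e^{2\pi i/3}$ (the Eisenstein integers), and let $\Lambda'\subset\mathbb{C}$ be the lattice generated by $1$ and $i$ (the Gaussian integers). Let $\Gamma_H\subset H_{\mathbb{C}}$ (respectively $\Gamma_0\subset H_{\mathbb{C}}$) be the discrete subgroup of the matrices with $u_1,u_2,u_3\in\Lambda$ (respectively $u_1,u_2,u_3\in\Lambda'$), acting on $H_{\mathbb{C}}$ by left multiplication. Let $N=\Gamma_H\backslash H_{\mathbb{C}}$, and let $N'=\Gamma_0\backslash H_{\mathbb{C}}$ be the Iwasawa manifold, both with their quotient structures of smooth manifolds. Then the fundamental groups $\pi_1(N)$ and $\pi_1(N')$ are not isomorphic (for any choice of base points). In particular, $N$ and $N'$ are not diffeomorphic. -/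

import Mathlib

open scoped Manifold ContDiff

noncomputable section

/-! ### The complex Heisenberg group -/

/-- The complex Heisenberg group `H_ℂ`: the point `(u₁, u₂, u₃)` stands for the unipotent matrix
`[1, u₂, u₃; 0, 1, u₁; 0, 0, 1]`, see `ComplexHeisenberg.toMatrix`. -/
@[ext]
structure ComplexHeisenberg where
  u₁ : ℂ
  u₂ : ℂ
  u₃ : ℂ

namespace ComplexHeisenberg

/-- The matrix represented by a point of the complex Heisenberg group. -/
def toMatrix (g : ComplexHeisenberg) : Matrix (Fin 3) (Fin 3) ℂ :=
  !![1, g.u₂, g.u₃; 0, 1, g.u₁; 0, 0, 1]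

instance : Mul ComplexHeisenberg :=
  ⟨fun g h => ⟨g.u₁ + h.u₁, g.u₂ + h.u₂, g.u₃ + h.u₃ + g.u₂ * h.u₁⟩⟩

instance : One ComplexHeisenberg := ⟨⟨0, 0, 0⟩⟩

instance : Inv ComplexHeisenberg :=
  ⟨fun g => ⟨-g.u₁, -g.u₂, -g.u₃ + g.u₂ * g.u₁⟩⟩

@[simp] theorem mul_u₁ (g h : ComplexHeisenberg) : (g * h).u₁ = g.u₁ + h.u₁ := rfl
@[simp] theorem mul_u₂ (g h : ComplexHeisenberg) : (g * h).u₂ = g.u₂ + h.u₂ := rfl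
@[simp] theorem mul_u₃ (g h : ComplexHeisenberg) :
    (g * h).u₃ = g.u₃ + h.u₃ + g.u₂ * h.u₁ := rfl
@[simp] theorem one_u₁ : (1 : ComplexHeisenberg).u₁ = 0 := rfl
@[simp] theorem one_u₂ : (1 : ComplexHeisenberg).u₂ = 0 := rfl
@[simp] theorem one_u₃ : (1 : ComplexHeisenberg).u₃ = 0 := rfl
@[simp] theorem inv_u₁ (g : ComplexHeisenberg) : (g⁻¹).u₁ = -g.u₁ := rfl
@[simp] theorem inv_u₂ (g : ComplexHeisenberg) : (g⁻¹).u₂ = -g.u₂ := rfl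
@[simp] theorem inv_u₃ (g : ComplexHeisenberg) : (g⁻¹).u₃ = -g.u₃ + g.u₂ * g.u₁ := rfl

instance : Group ComplexHeisenberg :=
  Group.ofLeftAxioms
    (fun a b c => by ext <;> simp <;> ring)
    (fun a => by ext <;> simp)
    (fun a => by ext <;> simp)

/-- The group law is matrix multiplication. -/
theorem toMatrix_mul (g h : ComplexHeisenberg) :
    (g * h).toMatrix = g.toMatrix * h.toMatrix := by
  ext i j
  fin_cases i <;> fin_cases j <;>
    simp [toMatrix, Matrix.mul_apply, Fin.sum_univ_three] <;> ring

theorem toMatrix_one : (1 : ComplexHeisenberg).toMatrix = 1 := by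
  ext i j
  fin_cases i <;> fin_cases j <;> simp [toMatrix]

theorem toMatrix_injective : Function.Injective toMatrix := by
  intro g h e
  have h1 := congrFun (congrFun e 1) 2
  have h2 := congrFun (congrFun e 0) 1
  have h3 := congrFun (congrFun e 0) 2
  simp [toMatrix] at h1 h2 h3
  ext <;> assumption

/-- The global coordinates `(u₁, u₂, u₃)`. -/
def coordEquiv : ComplexHeisenberg ≃ ℂ × ℂ × ℂ where
  toFun g := (g.u₁, g.u₂, g.u₃)
  invFun p := ⟨p.1, p.2.1, p.2.2⟩
  left_inv _ := rfl
  right_inv _ := rfl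

instance : TopologicalSpace ComplexHeisenberg :=
  TopologicalSpace.induced coordEquiv inferInstance

/-- The global coordinates as a homeomorphism. -/
def coord : ComplexHeisenberg ≃ₜ ℂ × ℂ × ℂ :=
  coordEquiv.toHomeomorphOfIsInducing ⟨rfl⟩

theorem coord_apply (g : ComplexHeisenberg) : coord g = (g.u₁, g.u₂, g.u₃) := rfl
theorem coord_symm_apply (p : ℂ × ℂ × ℂ) : coord.symm p = ⟨p.1, p.2.1, p.2.2⟩ := rfl

theorem continuous_u₁ : Continuous u₁ := continuous_fst.comp coord.continuous
theorem continuous_u₂ : Continuous u₂ :=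
  (continuous_fst.comp continuous_snd).comp coord.continuous
theorem continuous_u₃ : Continuous u₃ :=
  (continuous_snd.comp continuous_snd).comp coord.continuous

/-- The topology is the one of the space of complex matrices. -/
theorem isInducing_toMatrix : Topology.IsInducing toMatrix := by
  have hc : Continuous toMatrix := by
    refine continuous_matrix fun i j => ?_
    have := continuous_u₁
    have := continuous_u₂
    have := continuous_u₃
    fin_cases i <;> fin_cases j <;> simp [toMatrix] <;> first | exact continuous_const | assumption
  let f : Matrix (Fin 3) (Fin 3) ℂ → ℂ × ℂ × ℂ := fun A => (A 1 2, A 0 1, A 0 2)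
  have hf : Continuous f :=
    (continuous_id.matrix_elem 1 2).prodMk
      ((continuous_id.matrix_elem 0 1).prodMk (continuous_id.matrix_elem 0 2))
  have hcomp : f ∘ toMatrix = coord := by
    funext g
    simp [f, toMatrix, coord_apply]
  exact Topology.IsInducing.of_comp hc hf (hcomp ▸ coord.isInducing)

instance : T2Space ComplexHeisenberg := coord.symm.t2Space

instance : LocallyCompactSpace ComplexHeisenberg :=
  coord.isClosedEmbedding.locallyCompactSpace

instance : IsTopologicalGroup ComplexHeisenberg where
  continuous_mul := by
    have h₁ := continuous_u₁
    have h₂ := continuous_u₂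
    have h₃ := continuous_u₃
    refine coord.isInducing.continuous_iff.2 ?_
    change Continuous fun p : ComplexHeisenberg × ComplexHeisenberg =>
      (p.1.u₁ + p.2.u₁, p.1.u₂ + p.2.u₂, p.1.u₃ + p.2.u₃ + p.1.u₂ * p.2.u₁)
    fun_prop
  continuous_inv := by
    have h₁ := continuous_u₁
    have h₂ := continuous_u₂
    have h₃ := continuous_u₃
    refine coord.isInducing.continuous_iff.2 ?_
    change Continuous fun p : ComplexHeisenberg => (-p.u₁, -p.u₂, -p.u₃ + p.u₂ * p.u₁)
    fun_prop

/-- The smooth structure on `H_ℂ` given by the single global chart `(u₁, u₂, u₃)`. -/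
instance : ChartedSpace (ℂ × ℂ × ℂ) ComplexHeisenberg :=
  coord.toOpenPartialHomeomorph.singletonChartedSpace rfl

theorem chartAt_eq (g : ComplexHeisenberg) :
    chartAt (ℂ × ℂ × ℂ) g = coord.toOpenPartialHomeomorph := rfl

/-! ### Nilmanifolds of the complex Heisenberg group -/

/-- The subgroup of the matrices in `H_ℂ` with `u₁, u₂, u₃ ∈ R`. -/
def integralPoints (R : Subring ℂ) : Subgroup ComplexHeisenberg where
  carrier := {g | g.u₁ ∈ R ∧ g.u₂ ∈ R ∧ g.u₃ ∈ R}
  mul_mem' := fun ⟨a₁, a₂, a₃⟩ ⟨b₁, b₂, b₃⟩ =>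
    ⟨R.add_mem a₁ b₁, R.add_mem a₂ b₂, R.add_mem (R.add_mem a₃ b₃) (R.mul_mem a₂ b₁)⟩
  one_mem' := ⟨R.zero_mem, R.zero_mem, R.zero_mem⟩
  inv_mem' := fun ⟨a₁, a₂, a₃⟩ =>
    ⟨R.neg_mem a₁, R.neg_mem a₂, R.add_mem (R.neg_mem a₃) (R.mul_mem a₂ a₁)⟩

instance (R : Subring ℂ) [DiscreteTopology R] : DiscreteTopology (integralPoints R) := by
  let f : integralPoints R → R × R × R :=
    fun g => (⟨g.1.u₁, g.2.1⟩, ⟨g.1.u₂, g.2.2.1⟩, ⟨g.1.u₃, g.2.2.2⟩)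
  refine DiscreteTopology.of_continuous_injective (f := f) ?_ ?_
  · exact ((continuous_u₁.comp continuous_subtype_val).subtype_mk _).prodMk
      (((continuous_u₂.comp continuous_subtype_val).subtype_mk _).prodMk
        ((continuous_u₃.comp continuous_subtype_val).subtype_mk _))
  · intro g h e
    simp only [f, Prod.mk.injEq, Subtype.mk.injEq] at e
    exact Subtype.ext (ComplexHeisenberg.ext e.1 e.2.1 e.2.2)

instance (R : Subring ℂ) [DiscreteTopology R] :
    ProperlyDiscontinuousSMul (integralPoints R) ComplexHeisenberg :=
  Subgroup.properlyDiscontinuousSMul_of_tendsto_cofinite _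
    (Subgroup.tendsto_coe_cofinite_of_discrete _
      (isDiscrete_iff_discreteTopology.mpr
        (inferInstanceAs (DiscreteTopology (integralPoints R)))))

/-- The quotient of `H_ℂ` by the action of `integralPoints R` through left multiplication, with the
quotient topology. For discrete `R`, its charts are the local inverses of the projection followed
by `(u₁, u₂, u₃)`. -/
abbrev Nilmanifold (R : Subring ℂ) : Type :=
  MulAction.orbitRel.Quotient (integralPoints R) ComplexHeisenberg

/-- The charts of the quotient are smoothly compatible. -/
instance (R : Subring ℂ) [DiscreteTopology R] :
    IsManifold 𝓘(ℝ, ℂ × ℂ × ℂ) ∞ (Nilmanifold R) := by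
  have hcov := isQuotientCoveringMap_quotientMk_of_properlyDiscontinuousSMul
    (G := integralPoints R) (E := ComplexHeisenberg)
  have hloc := hcov.isCoveringMap.isLocalHomeomorph
  refine isManifold_of_contDiffOn _ _ _ ?_
  rintro _ _ ⟨q, rfl⟩ ⟨q', rfl⟩ x ⟨hx, -⟩
  apply ContDiffAt.contDiffWithinAt
  generalize (Quotient.mk_surjective (s := MulAction.orbitRel (integralPoints R)
    ComplexHeisenberg)).hasRightInverse.choose q = a at hx ⊢
  generalize (Quotient.mk_surjective (s := MulAction.orbitRel (integralPoints R)
    ComplexHeisenberg)).hasRightInverse.choose q' = b at hx ⊢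
  let π : ComplexHeisenberg → Nilmanifold R := Quotient.mk _
  have hsrc : π (coord.symm x) ∈ (hloc.localInverseAt b).source := by
    simpa [chartAt_eq, π] using hx.2
  have hfun : ∀ y, (𝓘(ℝ, ℂ × ℂ × ℂ) ∘ (((hloc.localInverseAt a).trans
      (chartAt (ℂ × ℂ × ℂ) a)).symm.trans ((hloc.localInverseAt b).trans
      (chartAt (ℂ × ℂ × ℂ) b))) ∘ 𝓘(ℝ, ℂ × ℂ × ℂ).symm) y
      = coord (hloc.localInverseAt b (π (coord.symm y))) := by
    intro y
    simp [π]
  have hπ : π (hloc.localInverseAt b (π (coord.symm x))) = π (coord.symm x) :=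
    hloc.apply_localInverseAt_of_mem hsrc
  obtain ⟨γ, hγ⟩ := hcov.apply_eq_iff_mem_orbit.1 hπ
  have hγ' : γ.1 * coord.symm x = hloc.localInverseAt b (π (coord.symm x)) := hγ
  have hcont : Continuous fun y => γ.1 * coord.symm y :=
    continuous_const.mul coord.symm.continuous
  have hev : ∀ᶠ y in nhds x, γ.1 * coord.symm y ∈ (hloc.localInverseAt b).target := by
    refine hcont.continuousAt.eventually_mem ((hloc.localInverseAt b).open_target.mem_nhds ?_)
    rw [hγ']
    exact (hloc.localInverseAt b).map_source hsrc
  have hsmooth : ContDiff ℝ ∞ fun y : ℂ × ℂ × ℂ =>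
      (γ.1.u₁ + y.1, γ.1.u₂ + y.2.1, γ.1.u₃ + y.2.2 + γ.1.u₂ * y.1) := by
    fun_prop
  refine hsmooth.contDiffAt.congr_of_eventuallyEq ?_
  filter_upwards [hev] with y hy
  rw [hfun]
  have h1 : π (coord.symm y) = π (γ.1 * coord.symm y) := (hcov.map_smul γ).symm
  have h2 : hloc.localInverseAt b (π (γ.1 * coord.symm y)) = γ.1 * coord.symm y := by
    have := (hloc.localInverseAt b).right_inv hy
    rwa [hloc.localInverseAt_symm] at this
  rw [h1, h2]
  rfl

end ComplexHeisenberg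

/-! ### The lattices and the two manifolds -/

theorem mul_mem_span_one_pair {τ : ℂ} (hτ : τ * τ ∈ Submodule.span ℤ {1, τ}) {x y : ℂ}
    (hx : x ∈ Submodule.span ℤ {1, τ}) (hy : y ∈ Submodule.span ℤ {1, τ}) :
    x * y ∈ Submodule.span ℤ {1, τ} := by
  obtain ⟨a, b, rfl⟩ := Submodule.mem_span_pair.1 hx
  obtain ⟨c, d, rfl⟩ := Submodule.mem_span_pair.1 hy
  obtain ⟨m, n, h⟩ := Submodule.mem_span_pair.1 hτ
  refine Submodule.mem_span_pair.2 ⟨a * c + b * d * m, a * d + b * c + b * d * n, ?_⟩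
  simp only [zsmul_eq_mul] at *
  push_cast
  linear_combination (b * d : ℂ) * h

/-- The lattice generated by `1` and `τ`, when it is closed under multiplication. -/
def latticeSubring (τ : ℂ) (hτ : τ * τ ∈ Submodule.span ℤ {1, τ}) : Subring ℂ where
  carrier := Submodule.span ℤ {1, τ}
  mul_mem' := mul_mem_span_one_pair hτ
  one_mem' := Submodule.subset_span (by simp)
  add_mem' := Submodule.add_mem _
  zero_mem' := Submodule.zero_mem _
  neg_mem' := Submodule.neg_mem _

theorem discreteTopology_latticeSubring (τ : ℂ) (hτ : τ * τ ∈ Submodule.span ℤ {1, τ})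
    (him : τ.im ≠ 0) : DiscreteTopology (latticeSubring τ hτ) := by
  have hli : LinearIndependent ℝ ![(1 : ℂ), τ] := by
    rw [LinearIndependent.pair_iff]
    intro s t h
    have h1 := congrArg Complex.re h
    have h2 := congrArg Complex.im h
    simp at h1 h2
    rcases h2 with h2 | h2
    · subst h2
      simpa using h1
    · exact absurd h2 him
  let L : PeriodPair := ⟨1, τ, hli⟩
  exact inferInstanceAs (DiscreteTopology L.lattice)

/-- The primitive cube root of unity `ζ = e^{2πi/3}`. -/
def zeta₃ : ℂ := Complex.exp (2 * Real.pi * Complex.I / 3)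

theorem zeta₃_eq : zeta₃ = -1 / 2 + (Real.sqrt 3 / 2 : ℝ) * Complex.I := by
  have h : 2 * (Real.pi : ℂ) * Complex.I / 3
      = ((Real.pi - Real.pi / 3 : ℝ) : ℂ) * Complex.I := by
    push_cast
    ring
  rw [zeta₃, h, Complex.exp_mul_I, ← Complex.ofReal_cos, ← Complex.ofReal_sin, Real.cos_pi_sub,
    Real.sin_pi_sub, Real.cos_pi_div_three, Real.sin_pi_div_three]
  push_cast
  ring

theorem zeta₃_mul_self : zeta₃ * zeta₃ ∈ Submodule.span ℤ {1, zeta₃} := by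
  refine Submodule.mem_span_pair.2 ⟨-1, -1, ?_⟩
  have h : ((Real.sqrt 3 : ℝ) : ℂ) ^ 2 = 3 := by
    rw [← Complex.ofReal_pow, Real.sq_sqrt (by norm_num)]
    norm_num
  rw [zeta₃_eq]
  push_cast
  simp only [zsmul_eq_mul]
  push_cast
  linear_combination (-(1 / 4 : ℂ) * ((Real.sqrt 3 : ℝ) : ℂ) ^ 2) * Complex.I_sq + (1 / 4 : ℂ) * h

theorem I_mul_self : Complex.I * Complex.I ∈ Submodule.span ℤ {1, Complex.I} :=
  Submodule.mem_span_pair.2 ⟨-1, 0, by simp⟩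

/-- The lattice `Λ ⊂ ℂ` generated by `1` and `ζ = e^{2πi/3}` (Eisenstein integers). -/
def eisensteinLattice : Subring ℂ := latticeSubring zeta₃ zeta₃_mul_self

/-- The lattice `Λ' ⊂ ℂ` generated by `1` and `i` (Gaussian integers). -/
def gaussianLattice : Subring ℂ := latticeSubring Complex.I I_mul_self

instance : DiscreteTopology eisensteinLattice :=
  discreteTopology_latticeSubring _ _ (by rw [zeta₃_eq]; simp)

instance : DiscreteTopology gaussianLattice :=
  discreteTopology_latticeSubring _ _ (by simp)

/-- The nilmanifold `N = Γ_H \ H_ℂ`, with `Γ_H` the matrices with entries in `Λ`. -/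
abbrev EisensteinNilmanifold : Type := ComplexHeisenberg.Nilmanifold eisensteinLattice

/-- The Iwasawa manifold `N' = Γ₀ \ H_ℂ`, with `Γ₀` the matrices with entries in `Λ'`. -/
abbrev IwasawaManifold : Type := ComplexHeisenberg.Nilmanifold gaussianLattice

end

/-! The contractible group $H_{\mathbb C}$ covers each quotient, so $\pi_1$ is the corresponding
lattice up to order of multiplication, and it is enough that no injective homomorphism `φ` sends the
Eisenstein lattice group to the Gaussian one (`not_injective_eisenstein_to_gaussian`). Commutators
are central and given by the determinant form $\omega(g,h)=g_2h_1-h_2g_1$. Multiplication by $\zeta$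
and $\zeta^2+\zeta+1=0$ become relations between commutators, which `φ` preserves. In the target,
the Plücker identity turns them into $A^2+AB+B^2=0$ with $A,B\in\mathbb Z[i]$. As
$\sqrt{-3}\notin\mathbb Q(i)$, this forces $B=0$ (`gaussianLattice_eq_zero_of_sq_add_mul_add_sq`),
so `φ` kills a nontrivial commutator. -/

open scoped commutatorElement

/-! ### Fundamental groups of the quotients. -/

instance ComplexHeisenberg.instContractibleSpace : ContractibleSpace ComplexHeisenberg :=
  ComplexHeisenberg.coord.contractibleSpace

/-- The fundamental group of a nilmanifold of `H_ℂ` is its lattice, up to the order of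
multiplication. -/
theorem ComplexHeisenberg.nonempty_fundamentalGroup_mulEquiv (R : Subring ℂ) [DiscreteTopology R]
    (x : Nilmanifold R) :
    Nonempty (FundamentalGroup (Nilmanifold R) x ≃* (integralPoints R)ᵐᵒᵖ) := by
  obtain ⟨e, he⟩ := Quotient.mk_surjective x
  exact ⟨(isQuotientCoveringMap_quotientMk_of_properlyDiscontinuousSMul
    (G := integralPoints R) (E := ComplexHeisenberg)).fundamentalGroupEquiv ⟨e, he⟩⟩

/-- A homeomorphism of spaces induces isomorphisms of fundamental groups. -/
theorem Homeomorph.nonempty_fundamentalGroup_mulEquiv {X Y : Type*} [TopologicalSpace X]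
    [TopologicalSpace Y] (f : X ≃ₜ Y) (x : X) :
    Nonempty (FundamentalGroup X x ≃* FundamentalGroup Y (f x)) := by
  have hinj (γ : FundamentalGroup X x) :
      FundamentalGroup.mapOfEq (f.symm : C(Y, X)) (f.symm_apply_apply x)
        (FundamentalGroup.map (f : C(X, Y)) x γ) = γ := by
    induction γ using Path.Homotopic.Quotient.ind with | mk γ
    rw [FundamentalGroup.mapOfEq_apply]
    refine congrArg Path.Homotopic.Quotient.mk (Path.ext (funext fun t => ?_))
    exact f.symm_apply_apply (γ t)
  refine ⟨MulEquiv.ofBijective (FundamentalGroup.map (f : C(X, Y)) x)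
    ⟨Function.LeftInverse.injective hinj, fun γ =>
      ⟨FundamentalGroup.mapOfEq (f.symm : C(Y, X)) (f.symm_apply_apply x) γ, ?_⟩⟩⟩
  induction γ using Path.Homotopic.Quotient.ind with | mk γ
  rw [FundamentalGroup.mapOfEq_apply]
  refine congrArg Path.Homotopic.Quotient.mk (Path.ext (funext fun t => ?_))
  exact f.apply_symm_apply (γ t)

/-! ### Arithmetic of the Gaussian integers. -/

/-- The form `a² + ab + b²`, of discriminant `-3`, has no nontrivial zero over the Gaussian
integers. -/
theorem gaussianLattice_eq_zero_of_sq_add_mul_add_sq {a b : ℂ} (ha : a ∈ gaussianLattice)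
    (hb : b ∈ gaussianLattice) (h : a ^ 2 + a * b + b ^ 2 = 0) : b = 0 := by
  obtain ⟨p, q, rfl⟩ := Submodule.mem_span_pair.1 ha
  obtain ⟨r, s, rfl⟩ := Submodule.mem_span_pair.1 hb
  have hre := congrArg Complex.re h
  have him := congrArg Complex.im h
  simp [pow_two] at hre him
  norm_cast at hre him
  -- Completing the square: $u+iv=2a+b$ and $b=r+is$, so $(u+iv)^2=-3b^2$; `h1` and `h2` are its
  -- real and imaginary parts.
  obtain ⟨u, hu⟩ : ∃ u, u = 2 * p + r := ⟨_, rfl⟩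
  obtain ⟨v, hv⟩ : ∃ v, v = 2 * q + s := ⟨_, rfl⟩
  have h1 : u ^ 2 - v ^ 2 + 3 * (r ^ 2 - s ^ 2) = 0 := by subst hu hv; linear_combination 4 * hre
  have h2 : u * v + 3 * (r * s) = 0 := by subst hu hv; linear_combination 2 * him
  -- Multiplying by $\bar b^2$ gives $((u+iv)\bar b)^2=-3|b|^4$. The number $(u+iv)\bar b$ has real
  -- part $ur+vs$ and imaginary part $vr-us$.
  have h3 : (u * r + v * s) * (v * r - u * s) = 0 := by
    linear_combination (r ^ 2 - s ^ 2) * h2 - r * s * h1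
  have h4 : (v * r - u * s) ^ 2 = (u * r + v * s) ^ 2 + 3 * (r ^ 2 + s ^ 2) ^ 2 := by
    linear_combination (s ^ 2 - r ^ 2) * h1 - 4 * r * s * h2
  have h5 : r ^ 2 + s ^ 2 = 0 := by
    by_contra hn
    have h6 : (0 : ℤ) < (r ^ 2 + s ^ 2) ^ 2 := by positivity
    rcases mul_eq_zero.1 h3 with h3 | h3
    -- Real part zero: $3$ would be the square of a rational.
    · rw [h3] at h4
      have h7 : (3 : ℚ) = ((v * r - u * s : ℤ) / (r ^ 2 + s ^ 2 : ℤ)) ^ 2 := by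
        rw [div_pow, eq_div_iff (by exact_mod_cast h6.ne')]
        exact_mod_cast (by linarith : (3 : ℤ) * (r ^ 2 + s ^ 2) ^ 2 = (v * r - u * s) ^ 2)
      refine Nat.prime_three.irrational_sqrt ⟨|((v * r - u * s : ℤ) / (r ^ 2 + s ^ 2 : ℤ) : ℚ)|, ?_⟩
      rw [Rat.cast_abs, ← Real.sqrt_sq_eq_abs]
      congr 1
      exact_mod_cast h7.symm
    -- Imaginary part zero: a negative number would be the square of a real one.
    · rw [h3] at h4
      nlinarith [sq_nonneg (u * r + v * s)]
  have hr : r = 0 := by nlinarith [sq_nonneg r, sq_nonneg s]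
  have hs : s = 0 := by nlinarith [sq_nonneg r, sq_nonneg s]
  simp [hr, hs]

/-! ### Commutators and the obstruction to an embedding. -/

namespace ComplexHeisenberg

theorem commutatorElement_u₃ (g h : ComplexHeisenberg) :
    ⁅g, h⁆.u₃ = g.u₂ * h.u₁ - h.u₂ * g.u₁ := by
  simp [commutatorElement_def]
  ring

theorem commutatorElement_eq (g h : ComplexHeisenberg) :
    ⁅g, h⁆ = ⟨0, 0, g.u₂ * h.u₁ - h.u₂ * g.u₁⟩ := by
  ext
  · simp [commutatorElement_def]
  · simp [commutatorElement_def]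
  · exact commutatorElement_u₃ g h

end ComplexHeisenberg

open ComplexHeisenberg in
/-- There is no embedding of the Eisenstein Heisenberg group into the Gaussian one. -/
theorem not_injective_eisenstein_to_gaussian
    (φ : integralPoints eisensteinLattice →* integralPoints gaussianLattice) :
    ¬ Function.Injective φ := by
  intro hφ
  have h0 : (0 : ℂ) ∈ eisensteinLattice := zero_mem _
  have h1 : (1 : ℂ) ∈ eisensteinLattice := one_mem _
  have hz : zeta₃ ∈ eisensteinLattice := Submodule.subset_span (by simp)
  have hzz : zeta₃ ^ 2 + zeta₃ + 1 = 0 := by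
    have h : ((Real.sqrt 3 : ℝ) : ℂ) ^ 2 = 3 := by
      rw [← Complex.ofReal_pow, Real.sq_sqrt (by norm_num)]
      norm_num
    rw [zeta₃_eq]
    push_cast
    linear_combination (1 / 4 * (Real.sqrt 3 : ℂ) ^ 2) * Complex.I_sq - 1 / 4 * h
  -- $X'$ and $Y'$ are $X$ and $Y$ with their nonzero coordinate multiplied by $\zeta$; $\omega$ is
  -- $\mathbb C$-bilinear, so $\zeta$ may pass from one argument to the other.
  let X : integralPoints eisensteinLattice := ⟨⟨1, 0, 0⟩, h1, h0, h0⟩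
  let X' : integralPoints eisensteinLattice := ⟨⟨zeta₃, 0, 0⟩, hz, h0, h0⟩
  let Y : integralPoints eisensteinLattice := ⟨⟨0, 1, 0⟩, h0, h1, h0⟩
  let Y' : integralPoints eisensteinLattice := ⟨⟨0, zeta₃, 0⟩, h0, hz, h0⟩
  have hXX : ⁅X, X'⁆ = 1 := Subtype.ext <| (commutatorElement_eq _ _).trans <| by
    ext <;> simp [X, X']
  have hYX : ⁅Y', X⁆ = ⁅Y, X'⁆ := Subtype.ext <| (commutatorElement_eq _ _).trans <|
    Eq.trans (by ext <;> simp [X, X', Y, Y']) (commutatorElement_eq _ _).symm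
  have hsum : ⁅Y', X'⁆ * ⁅Y, X'⁆ * ⁅Y, X⁆ = 1 := by
    refine Subtype.ext ?_
    change ⁅Y'.1, X'.1⁆ * ⁅Y.1, X'.1⁆ * ⁅Y.1, X.1⁆ = 1
    simp only [commutatorElement_eq]
    ext
    · simp
    · simp
    · simp [X, X', Y, Y']
      linear_combination hzz
  have hne : ⁅Y, X⁆ ≠ 1 := by
    intro h
    have h := congrArg (fun g => g.1.u₃) h
    change ⁅Y.1, X.1⁆.u₃ = 0 at h
    simp [commutatorElement_u₃, X, Y] at h
  have key {g h k l : integralPoints eisensteinLattice} (e : ⁅g, h⁆ = ⁅k, l⁆) :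
      ⁅(φ g).1, (φ h).1⁆ = ⁅(φ k).1, (φ l).1⁆ :=
    congrArg Subtype.val <| by simpa only [map_commutatorElement] using congrArg φ e
  -- Writing $1$ as $[1,1]$ lets `key` apply to a trivial commutator.
  have eXX := congrArg u₃ <| key (hXX.trans (commutatorElement_one_right 1).symm)
  have eYX := congrArg u₃ <| key hYX
  have esum : ⁅(φ Y').1, (φ X').1⁆ * ⁅(φ Y).1, (φ X').1⁆ * ⁅(φ Y).1, (φ X).1⁆ = 1 :=
    congrArg Subtype.val <| by
      simpa only [map_mul, map_commutatorElement, map_one] using congrArg φ hsum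
  have esum := congrArg u₃ esum
  simp only [commutatorElement_eq, mul_u₃, one_u₃, one_u₁, one_u₂, map_one, mul_zero,
    OneMemClass.coe_one, sub_zero, add_zero] at eXX eYX esum
  set a := (φ X).1
  set a' := (φ X').1
  set b := (φ Y).1
  set b' := (φ Y').1
  have hb : b.u₂ * a.u₁ - a.u₂ * b.u₁ = 0 := by
    refine gaussianLattice_eq_zero_of_sq_add_mul_add_sq (a := b.u₂ * a'.u₁ - a'.u₂ * b.u₁) ?_ ?_ ?_
    · exact sub_mem (mul_mem (φ Y).2.2.1 (φ X').2.1) (mul_mem (φ X').2.2.1 (φ Y).2.1)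
    · exact sub_mem (mul_mem (φ Y).2.2.1 (φ X).2.1) (mul_mem (φ X).2.2.1 (φ Y).2.1)
    -- Plücker: $\omega(b,a)\omega(b',a')-\omega(b,a')\omega(b',a)=\omega(b,b')\omega(a,a')$, and
    -- the right side vanishes by `eXX`. With $A=\omega(b,a')=\omega(b',a)$ and $B=\omega(b,a)$ this
    -- gives $B\,\omega(b',a')=A^2$, and $B$ times `esum` is the required equation.
    · linear_combination (b.u₂ * a.u₁ - a.u₂ * b.u₁) * esum
        - (b.u₂ * a'.u₁ - a'.u₂ * b.u₁) * eYX - (b.u₂ * b'.u₁ - b'.u₂ * b.u₁) * eXX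
  refine hne (hφ ?_)
  rw [map_commutatorElement, map_one]
  refine Subtype.ext <| (commutatorElement_eq _ _).trans ?_
  ext
  · rfl
  · rfl
  · exact hb

theorem mainTheorem8 :
    (∀ (x : EisensteinNilmanifold) (y : IwasawaManifold),
      IsEmpty (FundamentalGroup EisensteinNilmanifold x ≃* FundamentalGroup IwasawaManifold y)) ∧
    IsEmpty (EisensteinNilmanifold ≃ₘ^∞⟮𝓘(ℝ, ℂ × ℂ × ℂ), 𝓘(ℝ, ℂ × ℂ × ℂ)⟯ IwasawaManifold) := by
  have key (x : EisensteinNilmanifold) (y : IwasawaManifold) :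
      IsEmpty (FundamentalGroup EisensteinNilmanifold x ≃* FundamentalGroup IwasawaManifold y) := by
    refine ⟨fun f => ?_⟩
    obtain ⟨e⟩ := ComplexHeisenberg.nonempty_fundamentalGroup_mulEquiv _ x
    obtain ⟨e'⟩ := ComplexHeisenberg.nonempty_fundamentalGroup_mulEquiv _ y
    -- Both sides carry the opposite multiplication, so the isomorphism descends to the lattice
    -- groups themselves.
    let g := MulEquiv.op.symm (e.symm.trans (f.trans e'))
    exact not_injective_eisenstein_to_gaussian g.toMonoidHom g.injective
  refine ⟨key, ⟨fun f => ?_⟩⟩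
  let x : EisensteinNilmanifold := Quotient.mk _ 1
  obtain ⟨e⟩ := f.toHomeomorph.nonempty_fundamentalGroup_mulEquiv x
  exact (key x _).false e
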